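/- Let $m \ge 2$, let $D \subsetneq \mathbb{R}^m$ be an open set (in particular, $D$ may be any domain $D\subsetneq\mathbb{R}^m$), and let $d_D$ be the signed distance function to $\partial D$, i.e. $d_D(x) = \min_{y \in \partial D} |x-y|$ for $x \in D$ and $d_D(x) = -\min_{y \in \partial D} |x-y|$ for $x \in \mathbb{R}^m \setminus D$. Let $p \in \partial D$ and let $U$ be an open neighborhood of $p$ such that $d_D$ is differentiable at every point of $U$. Then $d_D \in \mathcal{C}^{1,1}(U)$, i.e. $d_D$ is $\mathcal C^1$ on $U$ and $\nabla d_D$ is locally Lipschitz on $U$. Moreover, $\partial D$ is $\mathcal{C}^{1,1}$-smooth near $p$: there are a unit vector $\nu$, a number $r>0$ and a $\mathcal C^{1,1}$ function $f$ (in the same sense) on the ball $\{y \in \nu^\perp : |y|<r\}$ such that, for all $y\in\nu^\perp$ with $|y|<r$ and all $t\in(-r,r)$, $p+y+t\nu\in D$ if and only if $t>f(y)$. -/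

import Mathlib

/-- The signed distance function to the boundary of `D`: the distance to `∂D` on `D`,
and minus the distance to `∂D` on the complement of `D`. -/
noncomputable def signedDistance {E : Type*} [PseudoMetricSpace E] (D : Set E) (x : E) : ℝ :=
  open Classical in
  if x ∈ D then Metric.infDist x (frontier D) else -Metric.infDist x (frontier D)

/-- `f` is of class `C^{1,1}` on the open set `U`: it is `C^1` on `U` and its gradient is
locally Lipschitz on `U`. -/
def IsC11On {F : Type*} [NormedAddCommGroup F] [InnerProductSpace ℝ F] [CompleteSpace F]
    (f : F → ℝ) (U : Set F) : Prop :=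
  ContDiffOn ℝ 1 f U ∧ LocallyLipschitzOn U (gradient f)

/-- `p ∈ ∂D` is a `C^{1,1}`-smooth boundary point of `D`: for some unit vector `ν`, writing the
points of the cylinder of radius `r` and half-height `r` around `p` as `p + y + t ν` with
`y ⊥ ν`, the part of `D` in this cylinder is `{t > f y}`, where `f` is a `C^{1,1}` function on the
ball of radius `r` in the hyperplane orthogonal to `ν`. (In the cylinder, `∂D` is then the
graph `{t = f y}`.) -/
def IsC11BoundaryPoint {E : Type*} [NormedAddCommGroup E] [InnerProductSpace ℝ E]
    [CompleteSpace E] (D : Set E) (p : E) : Prop :=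
  p ∈ frontier D ∧
    ∃ ν : E, ‖ν‖ = 1 ∧
      ∃ r : ℝ, 0 < r ∧
        ∃ f : (Submodule.span ℝ {ν})ᗮ → ℝ,
          IsC11On f (Metric.ball 0 r) ∧
            ∀ y ∈ Metric.ball (0 : (Submodule.span ℝ {ν})ᗮ) r, ∀ t ∈ Set.Ioo (-r) r,
              (p + (y : E) + t • ν ∈ D ↔ f y < t)

open Metric Set Filter Topology
open scoped RealInnerProductSpace

/-! ### The signed distance is 1-Lipschitz. -/

section SignedDistance

section PseudoMetricSpace

variable {E : Type*} [PseudoMetricSpace E] {D : Set E} {x : E}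

/-! The signed distance `d` is 1-Lipschitz, and everything rests on `|∇d| = 1` throughout `U`. Off
`∂D` this holds since `d` changes at maximal rate towards a nearest boundary point.

If a 1-Lipschitz `f` has unit gradient on a ball of radius `s` about `x`, then `f z = f x + s` for
some `z` at distance `s` (`LipschitzWith.exists_eq_add_of_norm_gradient_eq_one`). So the cone `f z -
|· - z|` lies below `f` and touches it at `x`; the same for `-f` gives a cone above. The resulting
two-sided quadratic bounds, uniform in `x`, make the gradient Lipschitz
(`norm_sub_le_of_quadratic_bound`).

The existence of `z` needs unit gradient only where `f ≥ f x`. Centred at `y ∈ D`, this set misses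
`∂D`; letting `y` tend to a boundary point gives maximal growth, hence unit gradient, there too.
Finally, near `p`, `∂D` is a regular level set of `d`, and an implicit function argument makes it a
graph. -/

theorem signedDistance_of_mem (hx : x ∈ D) : signedDistance D x = infDist x (frontier D) := by
  simp [signedDistance, hx]

theorem signedDistance_of_notMem (hx : x ∉ D) :
    signedDistance D x = -infDist x (frontier D) := by
  simp [signedDistance, hx]

theorem signedDistance_of_mem_frontier (hx : x ∈ frontier D) : signedDistance D x = 0 := by
  simp [signedDistance, infDist_zero_of_mem hx]

theorem signedDistance_pos_iff (hD : IsOpen D) (hne : (frontier D).Nonempty) :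
    0 < signedDistance D x ↔ x ∈ D := by
  constructor
  · intro h
    by_contra hx
    rw [signedDistance_of_notMem hx] at h
    linarith [infDist_nonneg (x := x) (s := frontier D)]
  · intro hx
    rw [signedDistance_of_mem hx, ← isClosed_frontier.notMem_iff_infDist_pos hne]
    exact fun h => (disjoint_frontier_iff_isOpen.2 hD).le_bot ⟨h, hx⟩

end PseudoMetricSpace

variable {E : Type*} [NormedAddCommGroup E] [InnerProductSpace ℝ E] {D : Set E} {x y : E}

theorem segment_inter_frontier_nonempty (hx : x ∈ D) (hy : y ∉ D) :
    (segment ℝ x y ∩ frontier D).Nonempty := by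
  by_contra! h
  have hsub : segment ℝ x y ⊆ interior D ∪ (closure D)ᶜ := by
    intro z hz
    by_contra! hz'
    have : z ∈ segment ℝ x y ∩ frontier D := by
      refine ⟨hz, ?_, fun h1 => hz' (Or.inl h1)⟩
      by_contra h2
      exact hz' (Or.inr h2)
    rw [h] at this
    exact this
  have hxs := left_mem_segment ℝ x y
  have hys := right_mem_segment ℝ x y
  have h1 : x ∈ interior D := by
    rcases hsub hxs with h1 | h1
    · exact h1
    · exact absurd (subset_closure hx) h1
  have h2 : y ∈ (closure D)ᶜ := by
    rcases hsub hys with h2 | h2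
    · exact absurd (interior_subset h2) hy
    · exact h2
  obtain ⟨z, -, hz1, hz2⟩ := (convex_segment x y).isPreconnected _ _ isOpen_interior
    isClosed_closure.isOpen_compl hsub ⟨x, hxs, h1⟩ ⟨y, hys, h2⟩
  exact hz2 (subset_closure (interior_subset hz1))

/-- When `x` and `y` lie on different sides, the segment between them meets `∂D`, so the two
distances to `∂D` add up to at most `dist x y`. -/
theorem lipschitzWith_signedDistance (D : Set E) : LipschitzWith 1 (signedDistance D) := by
  have key : ∀ {x y : E}, x ∈ D → y ∉ D → infDist x (frontier D) + infDist y (frontier D)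
      ≤ dist x y := by
    intro x y hx hy
    obtain ⟨z, hz, hzf⟩ := segment_inter_frontier_nonempty hx hy
    have h1 := infDist_le_dist_of_mem (x := x) hzf
    have h2 := infDist_le_dist_of_mem (x := y) hzf
    rw [dist_comm y z] at h2
    linarith [dist_add_dist_of_mem_segment hz]
  refine LipschitzWith.of_le_add fun x y => ?_
  by_cases hx : x ∈ D <;> by_cases hy : y ∈ D
  · rw [signedDistance_of_mem hx, signedDistance_of_mem hy]
    exact infDist_le_infDist_add_dist
  · rw [signedDistance_of_mem hx, signedDistance_of_notMem hy]
    linarith [key hx hy]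
  · rw [signedDistance_of_notMem hx, signedDistance_of_mem hy]
    have h1 := infDist_nonneg (x := x) (s := frontier D)
    have h2 := infDist_nonneg (x := y) (s := frontier D)
    linarith [dist_nonneg (x := x) (y := y)]
  · rw [signedDistance_of_notMem hx, signedDistance_of_notMem hy]
    have := infDist_le_infDist_add_dist (x := y) (y := x) (s := frontier D)
    rw [dist_comm y x] at this
    linarith

end SignedDistance

/-! ### Maximal growth of 1-Lipschitz functions. -/

section Gradient

theorem LipschitzWith.sub_le_norm {E : Type*} [SeminormedAddCommGroup E] {f : E → ℝ}
    (hf : LipschitzWith 1 f) (x y : E) :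
    f x - f y ≤ ‖x - y‖ := by
  have := hf.dist_le_mul x y
  rw [Real.dist_eq, dist_eq_norm] at this
  have h2 := le_abs_self (f x - f y)
  push_cast at this
  linarith

variable {E : Type*} [NormedAddCommGroup E] [InnerProductSpace ℝ E] [CompleteSpace E]
  {f : E → ℝ} {x y z : E}

theorem gradient_fun_neg (f : E → ℝ) (x : E) :
    gradient (fun z => -f z) x = -gradient f x := by
  simp [gradient, fderiv_fun_neg]

theorem fderiv_apply_eq_inner_gradient (f : E → ℝ) (x v : E) :
    fderiv ℝ f x v = ⟪gradient f x, v⟫ := by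
  rw [← toDual_gradient, InnerProductSpace.toDual_apply_apply]

theorem norm_gradient (f : E → ℝ) (x : E) : ‖gradient f x‖ = ‖fderiv ℝ f x‖ := by
  simp [gradient]

theorem LipschitzWith.norm_gradient_le_one (hf : LipschitzWith 1 f) (x : E) :
    ‖gradient f x‖ ≤ 1 := by
  rw [norm_gradient]
  exact_mod_cast norm_fderiv_le_of_lipschitz ℝ hf

theorem inner_gradient_le_of_eventually_le (hf : DifferentiableAt ℝ f x) (v : E) {c : ℝ}
    (h : ∀ᶠ t in 𝓝[>] (0 : ℝ), f (x + t • v) ≤ f x + c * t) :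
    ⟪gradient f x, v⟫ ≤ c := by
  have h1 : HasDerivAt (fun t : ℝ => f (x + t • v)) ⟪gradient f x, v⟫ 0 := by
    have h2 : HasDerivAt (fun t : ℝ => x + t • v) v 0 := by
      simpa using ((hasDerivAt_id (0 : ℝ)).smul_const v).const_add x
    have h3 : HasFDerivAt f (fderiv ℝ f x) (x + (0 : ℝ) • v) := by simpa using hf.hasFDerivAt
    rw [← fderiv_apply_eq_inner_gradient]
    exact h3.comp_hasDerivAt 0 h2
  have h4 := (hasDerivAt_iff_tendsto_slope.1 h1).mono_left
    (nhdsWithin_mono (0 : ℝ) (s := Ioi 0) (fun t (ht : 0 < t) => ne_of_gt ht))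
  refine le_of_tendsto h4 ?_
  filter_upwards [h, self_mem_nhdsWithin] with t ht ht0
  have ht0 : 0 < t := ht0
  rw [slope_def_field, div_le_iff₀ (by linarith)]
  simp only [zero_smul, add_zero, sub_zero]
  linarith

/-- If a `1`-Lipschitz function grows at maximal rate between `x` and `z`, then its gradient at `x`
is the unit vector pointing towards `z`. -/
theorem LipschitzWith.sub_eq_norm_smul_gradient (hf : LipschitzWith 1 f)
    (hd : DifferentiableAt ℝ f x) (h : f z = f x + ‖z - x‖) :
    z - x = ‖z - x‖ • gradient f x := by
  have h1 : ‖z - x‖ ≤ ⟪gradient f x, z - x⟫ := by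
    have := inner_gradient_le_of_eventually_le (f := fun w => -f w) hd.neg (z - x)
      (c := -‖z - x‖) ?_
    · rw [gradient_fun_neg, inner_neg_left] at this
      linarith
    · filter_upwards [Ioo_mem_nhdsGT (show (0 : ℝ) < 1 by norm_num)] with t ht
      have h2 := hf.sub_le_norm z (x + t • (z - x))
      have h3 : z - (x + t • (z - x)) = (1 - t) • (z - x) := by module
      rw [h3, norm_smul, Real.norm_of_nonneg (by linarith [ht.2])] at h2
      linarith
  have h2 := hf.norm_gradient_le_one x
  -- Equality case of Cauchy–Schwarz.
  have h3 : ‖(z - x) - ‖z - x‖ • gradient f x‖ ^ 2 ≤ 0 := by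
    rw [norm_sub_sq_real, norm_smul, inner_smul_right, real_inner_comm, norm_norm]
    have h4 : ‖gradient f x‖ ^ 2 ≤ 1 := by nlinarith [norm_nonneg (gradient f x)]
    nlinarith [norm_nonneg (z - x), sq_nonneg ‖z - x‖]
  have h5 : ‖(z - x) - ‖z - x‖ • gradient f x‖ = 0 := by
    nlinarith [norm_nonneg ((z - x) - ‖z - x‖ • gradient f x)]
  exact sub_eq_zero.1 (norm_eq_zero.1 h5)

theorem LipschitzWith.norm_gradient_eq_one (hf : LipschitzWith 1 f)
    (hd : DifferentiableAt ℝ f x) (hne : z ≠ x) (h : f z = f x + ‖z - x‖) :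
    ‖gradient f x‖ = 1 := by
  have h1 := congrArg norm (hf.sub_eq_norm_smul_gradient hd h)
  rw [norm_smul, norm_norm] at h1
  have h2 : ‖z - x‖ ≠ 0 := norm_ne_zero_iff.2 (sub_ne_zero.2 hne)
  field_simp at h1
  exact h1.symm

/-- A `1`-Lipschitz function whose gradient has norm one where it is at least `f x` on a closed
ball around `x` attains the largest possible value on that ball. -/
theorem LipschitzWith.exists_eq_add_of_norm_gradient_eq_one [ProperSpace E]
    (hf : LipschitzWith 1 f) {s : ℝ} (hs : 0 ≤ s)
    (hd : ∀ z ∈ closedBall x s, DifferentiableAt ℝ f z)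
    (hg : ∀ z ∈ closedBall x s, f x ≤ f z → ‖gradient f z‖ = 1) :
    ∃ z, ‖z - x‖ = s ∧ f z = f x + s := by
  have hne : (closedBall x s).Nonempty := ⟨x, mem_closedBall_self hs⟩
  obtain ⟨w, hw, hwmax⟩ := (isCompact_closedBall x s).exists_isMaxOn hne hf.continuous.continuousOn
  -- Penalise by a cone of slope `c < 1`. At an interior maximum of `f - c‖· - x‖`, moving along the
  -- unit gradient gains at rate 1 and costs at most `c`, so the maximum lies on the sphere. Then `c
  -- → 1`.
  have key : ∀ c ∈ Ioo (0 : ℝ) 1, f x + c * s ≤ f w := by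
    intro c hc
    obtain ⟨z, hz, hzmax⟩ := (isCompact_closedBall x s).exists_isMaxOn hne
      (f := fun z => f z - c * ‖z - x‖)
      (by have := hf.continuous; fun_prop)
    have hzx := hzmax (mem_closedBall_self hs)
    simp only [mem_ofPred_eq, sub_self, norm_zero, mul_zero, sub_zero] at hzx
    have hzs : ‖z - x‖ ≤ s := by simpa [dist_eq_norm] using hz
    rcases hzs.eq_or_lt with h | h
    · have := hwmax hz
      simp only [mem_ofPred_eq] at this
      rw [h] at hzx
      linarith
    · exfalso
      have hg1 : ‖gradient f z‖ = 1 :=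
        hg z hz (by nlinarith [mul_nonneg hc.1.le (norm_nonneg (z - x))])
      have h1 := inner_gradient_le_of_eventually_le (hd z hz) (gradient f z) (c := c) ?_
      · rw [real_inner_self_eq_norm_sq, hg1] at h1
        linarith [hc.2]
      · have h2 : ∀ᶠ t in 𝓝 (0 : ℝ), z + t • gradient f z ∈ ball x s := by
          have hcont : ContinuousAt (fun t : ℝ => z + t • gradient f z) 0 := by fun_prop
          refine hcont.eventually_mem (isOpen_ball.mem_nhds ?_)
          simpa [dist_eq_norm] using h
        filter_upwards [h2.filter_mono nhdsWithin_le_nhds, self_mem_nhdsWithin] with t ht ht0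
        have ht0 : 0 < t := ht0
        have h3 := hzmax (ball_subset_closedBall ht)
        simp only [mem_ofPred_eq] at h3
        have h4 : ‖z + t • gradient f z - x‖ ≤ ‖z - x‖ + t := by
          have : z + t • gradient f z - x = (z - x) + t • gradient f z := by abel
          rw [this]
          refine (norm_add_le _ _).trans ?_
          rw [norm_smul, hg1, Real.norm_of_nonneg ht0.le, mul_one]
        nlinarith [mul_le_mul_of_nonneg_left h4 hc.1.le]
  have hws : ‖w - x‖ ≤ s := by simpa [dist_eq_norm] using hw
  have h1 : f x + s ≤ f w := by
    have hcont : Tendsto (fun c : ℝ => f x + c * s) (𝓝[<] 1) (𝓝 (f x + 1 * s)) :=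
      (Continuous.tendsto (by fun_prop) 1).mono_left nhdsWithin_le_nhds
    rw [one_mul] at hcont
    refine le_of_tendsto hcont ?_
    filter_upwards [Ioo_mem_nhdsLT (show (0 : ℝ) < 1 by norm_num)] with c hc using key c hc
  have h2 := hf.sub_le_norm w x
  exact ⟨w, by linarith, by linarith⟩

/-- A `1`-Lipschitz function lies above a paraboloid at `x` if it grows at maximal rate from `x`
to a point at distance `s`. -/
theorem LipschitzWith.quadratic_lower_bound (hf : LipschitzWith 1 f)
    (hd : DifferentiableAt ℝ f x) {s : ℝ} (hs : 0 < s)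
    (h : ∃ z, ‖z - x‖ = s ∧ f z = f x + s) (w : E) :
    f x + ⟪gradient f x, w - x⟫ - ‖w - x‖ ^ 2 / (2 * s) ≤ f w := by
  obtain ⟨z, hz, hfz⟩ := h
  have h1 := hf.sub_eq_norm_smul_gradient hd (by rw [hfz, hz])
  have h2 := hf.norm_gradient_eq_one hd (z := z)
    (by rintro rfl; rw [sub_self, norm_zero] at hz; exact hs.ne hz)
    (by rw [hfz, hz])
  rw [hz] at h1
  have h3 := hf.sub_le_norm z w
  have h4 : z - w = s • gradient f x - (w - x) := by rw [← h1]; abel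
  have h5 : ‖z - w‖ ^ 2 = s ^ 2 - 2 * s * ⟪gradient f x, w - x⟫ + ‖w - x‖ ^ 2 := by
    rw [h4, norm_sub_sq_real, norm_smul, h2, real_inner_smul_left, Real.norm_of_nonneg hs.le]
    ring
  have h6 : ‖z - w‖ ≤ s - ⟪gradient f x, w - x⟫ + ‖w - x‖ ^ 2 / (2 * s) := by
    -- AM–GM replaces the distance by its square, which expands exactly.
    have h7 : 0 ≤ (‖z - w‖ - s) ^ 2 := sq_nonneg _
    have h8 : ‖z - w‖ ≤ (‖z - w‖ ^ 2 + s ^ 2) / (2 * s) := by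
      rw [le_div_iff₀ (by positivity)]
      nlinarith
    refine h8.trans (le_of_eq ?_)
    rw [h5]
    field_simp
    ring
  linarith

end Gradient

/-! ### From unit gradient to `C^{1,1}`. -/

section Regularity

variable {E : Type*} [NormedAddCommGroup E] [InnerProductSpace ℝ E] [CompleteSpace E]
  {f : E → ℝ} {x y z : E} {U : Set E}

theorem isC11On_of_locallyLipschitzOn_gradient (hU : IsOpen U) (hd : DifferentiableOn ℝ f U)
    (hL : LocallyLipschitzOn U (gradient f)) : IsC11On f U := by
  refine ⟨?_, hL⟩
  rw [show (1 : WithTop ℕ∞) = 0 + 1 from rfl, contDiffOn_succ_iff_fderiv_of_isOpen hU]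
  refine ⟨hd, by simp, contDiffOn_zero.2 ?_⟩
  rw [← toDual_comp_gradient]
  exact (InnerProductSpace.toDual ℝ E).continuous.comp_continuousOn hL.continuousOn

/-- A differentiable `1`-Lipschitz function whose gradient has norm one satisfies a two-sided
quadratic bound. -/
theorem LipschitzWith.abs_sub_inner_gradient_le [ProperSpace E] (hf : LipschitzWith 1 f)
    (hU : IsOpen U) (hd : DifferentiableOn ℝ f U) (hg : ∀ z ∈ U, ‖gradient f z‖ = 1)
    {s : ℝ} (hs : 0 < s) (hx : closedBall x s ⊆ U) (w : E) :
    |f w - f x - ⟪gradient f x, w - x⟫| ≤ ‖w - x‖ ^ 2 / (2 * s) := by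
  have hd' : ∀ z ∈ closedBall x s, DifferentiableAt ℝ f z := fun z hz =>
    hd.differentiableAt (hU.mem_nhds (hx hz))
  have hxx := mem_closedBall_self (x := x) hs.le
  have h1 := hf.quadratic_lower_bound (hd' x hxx) hs
    (hf.exists_eq_add_of_norm_gradient_eq_one hs.le hd' fun z hz _ => hg z (hx hz)) w
  have hf' : LipschitzWith 1 (fun z => -f z) := hf.neg
  have h2 := hf'.quadratic_lower_bound (hd' x hxx).neg hs
    (hf'.exists_eq_add_of_norm_gradient_eq_one hs.le (fun z hz => (hd' z hz).neg)
      fun z hz _ => by rw [gradient_fun_neg, norm_neg, hg z (hx hz)]) w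
  rw [gradient_fun_neg, inner_neg_left] at h2
  rw [abs_le]
  constructor <;> linarith

theorem norm_sub_le_of_quadratic_bound {E : Type*} [NormedAddCommGroup E]
    [InnerProductSpace ℝ E] {f : E → ℝ} {x y u v : E} {c : ℝ} (hc : 0 < c)
    (hx : ∀ w, |f w - f x - ⟪u, w - x⟫| ≤ c * ‖w - x‖ ^ 2)
    (hy : ∀ w, |f w - f y - ⟪v, w - y⟫| ≤ c * ‖w - y‖ ^ 2) :
    ‖u - v‖ ≤ 6 * c * ‖x - y‖ := by
  -- Both expansions are compared at `x + t • (u - v)`; this `t` lets half of `t‖u - v‖²` absorb the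
  -- quadratic error.
  set t : ℝ := 1 / (6 * c) with ht
  have htc : c * t = 1 / 6 := by rw [ht]; field_simp
  have ht0 : 0 < t := by positivity
  have h1 := (abs_le.1 (hx (x + t • (u - v)))).1
  have h2 := (abs_le.1 (hy (x + t • (u - v)))).2
  have h3 := (abs_le.1 (hy x)).1
  have h4 : x + t • (u - v) - x = t • (u - v) := by abel
  have h5 : x + t • (u - v) - y = t • (u - v) + (x - y) := by abel
  rw [h4, norm_smul, Real.norm_of_nonneg ht0.le, inner_smul_right] at h1
  rw [h5, inner_add_right, inner_smul_right] at h2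
  have h6 : ‖t • (u - v) + (x - y)‖ ^ 2 ≤ 2 * (t * ‖u - v‖) ^ 2 + 2 * ‖x - y‖ ^ 2 := by
    have h7 := norm_add_le (t • (u - v)) (x - y)
    rw [norm_smul, Real.norm_of_nonneg ht0.le] at h7
    nlinarith [norm_nonneg (t • (u - v) + (x - y)), sq_nonneg (t * ‖u - v‖ - ‖x - y‖)]
  have h8 : ⟪u, u - v⟫ - ⟪v, u - v⟫ = ‖u - v‖ ^ 2 := by
    rw [← inner_sub_left, real_inner_self_eq_norm_sq]
  have h9 : t * ‖u - v‖ ^ 2 ≤ c * (3 * (t * ‖u - v‖) ^ 2 + 3 * ‖x - y‖ ^ 2) := by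
    rw [← h8]
    nlinarith
  have h10 : c * (3 * (t * ‖u - v‖) ^ 2) = t * ‖u - v‖ ^ 2 / 2 := by
    have : c * (3 * (t * ‖u - v‖) ^ 2) = 3 * (c * t) * (t * ‖u - v‖ ^ 2) := by ring
    rw [this, htc]; ring
  have h11 : ‖u - v‖ ^ 2 ≤ (6 * c * ‖x - y‖) ^ 2 := by
    have h12 : t * ‖u - v‖ ^ 2 ≤ 6 * c * ‖x - y‖ ^ 2 := by linarith
    have h13 := mul_le_mul_of_nonneg_left h12 (show 0 ≤ 6 * c by positivity)
    have h14 : 6 * c * (t * ‖u - v‖ ^ 2) = 6 * (c * t) * ‖u - v‖ ^ 2 := by ring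
    rw [h14, htc] at h13
    linarith
  exact le_of_sq_le_sq h11 (by positivity)

theorem LipschitzWith.isC11On_of_norm_gradient_eq_one [ProperSpace E] (hf : LipschitzWith 1 f)
    (hU : IsOpen U) (hd : DifferentiableOn ℝ f U) (hg : ∀ z ∈ U, ‖gradient f z‖ = 1) :
    IsC11On f U := by
  refine isC11On_of_locallyLipschitzOn_gradient hU hd fun x hx => ?_
  obtain ⟨R, hR, hRU⟩ := Metric.isOpen_iff.1 hU x hx
  -- Small enough that one radius `s` serves every centre in `ball x s`.
  set s := R / 3 with hs
  have hs0 : 0 < s := by positivity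
  have hsub : ∀ y ∈ ball x s, closedBall y s ⊆ U := fun y hy z hz => by
    refine hRU ?_
    rw [mem_ball] at hy ⊢
    rw [mem_closedBall] at hz
    linarith [dist_triangle z y x]
  refine ⟨(3 / s).toNNReal, ball x s, mem_nhdsWithin_of_mem_nhds (ball_mem_nhds x hs0),
    LipschitzOnWith.of_dist_le_mul fun y hy z hz => ?_⟩
  rw [Real.coe_toNNReal _ (by positivity), dist_eq_norm, dist_eq_norm]
  have key : ∀ y ∈ ball x s, ∀ w, |f w - f y - ⟪gradient f y, w - y⟫|
      ≤ 1 / (2 * s) * ‖w - y‖ ^ 2 := fun y hy w =>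
    (hf.abs_sub_inner_gradient_le hU hd hg hs0 (hsub y hy) w).trans (le_of_eq (by ring))
  refine (norm_sub_le_of_quadratic_bound (by positivity) (key y hy) (key z hz)).trans
    (le_of_eq ?_)
  field_simp
  ring

end Regularity

/-! ### The signed distance has unit gradient. -/

section SignedDistance

variable {E : Type*} [NormedAddCommGroup E] [InnerProductSpace ℝ E] [CompleteSpace E]
  [ProperSpace E] {D U : Set E} {x : E}

theorem norm_gradient_signedDistance_of_notMem_frontier (hne : (frontier D).Nonempty)
    (hx : x ∉ frontier D) (hd : DifferentiableAt ℝ (signedDistance D) x) :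
    ‖gradient (signedDistance D) x‖ = 1 := by
  have hL := lipschitzWith_signedDistance D
  obtain ⟨q, hq, hqx⟩ := isClosed_frontier.exists_infDist_eq_dist hne x
  have hqne : q ≠ x := fun h => hx (h ▸ hq)
  rw [dist_comm, dist_eq_norm] at hqx
  have hq0 := signedDistance_of_mem_frontier hq
  by_cases hxD : x ∈ D
  · have hL' : LipschitzWith 1 (fun z => -signedDistance D z) := hL.neg
    have := hL'.norm_gradient_eq_one hd.neg hqne
      (by rw [hq0, signedDistance_of_mem hxD, hqx]; ring)
    rwa [gradient_fun_neg, norm_neg] at this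
  · exact hL.norm_gradient_eq_one hd hqne
      (by rw [hq0, signedDistance_of_notMem hxD, hqx]; ring)

theorem norm_gradient_signedDistance_of_mem_frontier (hD : IsOpen D) (hU : IsOpen U)
    (hd : DifferentiableOn ℝ (signedDistance D) U) (hxU : x ∈ U) (hx : x ∈ frontier D) :
    ‖gradient (signedDistance D) x‖ = 1 := by
  have hL := lipschitzWith_signedDistance D
  have hne : (frontier D).Nonempty := ⟨x, hx⟩
  have hd' : ∀ z ∈ U, DifferentiableAt ℝ (signedDistance D) z := fun z hz =>
    hd.differentiableAt (hU.mem_nhds hz)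
  obtain ⟨R, hR, hRU⟩ := Metric.isOpen_iff.1 hU x hxU
  set s := R / 3 with hs
  have hs0 : 0 < s := by positivity
  have hx0 := signedDistance_of_mem_frontier hx
  obtain ⟨w, hw, hwmax⟩ := (isCompact_closedBall x s).exists_isMaxOn
    ⟨x, mem_closedBall_self hs0.le⟩ hL.continuous.continuousOn
  have hws : ‖w - x‖ ≤ s := by simpa [dist_eq_norm] using hw
  -- Maximal growth from `y ∈ D` near `x`, shifted by `x - y`, loses at most `dist x y`.
  have key : s ≤ signedDistance D w := by
    refine le_of_forall_pos_sub_le fun η hη => ?_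
    obtain ⟨y, hyD, hxy⟩ := Metric.mem_closure_iff.1 hx.1 (min η s) (lt_min hη hs0)
    have hy0 := (signedDistance_pos_iff hD hne).2 hyD
    have hsub : closedBall y s ⊆ U := fun z hz => by
      refine hRU ?_
      rw [mem_closedBall] at hz
      rw [mem_ball]
      rw [dist_comm] at hxy
      linarith [dist_triangle z y x, min_le_right η s]
    obtain ⟨z, hz, hfz⟩ := hL.exists_eq_add_of_norm_gradient_eq_one (x := y) hs0.le
      (fun z hz => hd' z (hsub hz)) fun z hz hle =>
        norm_gradient_signedDistance_of_notMem_frontier hne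
          (fun h => by rw [signedDistance_of_mem_frontier h] at hle; linarith) (hd' z (hsub hz))
    have h1 := hwmax (show z - y + x ∈ closedBall x s by simp [dist_eq_norm, hz])
    simp only [mem_ofPred_eq] at h1
    have h2 := hL.sub_le_norm z (z - y + x)
    have h3 : z - (z - y + x) = -(x - y) := by abel
    rw [h3, norm_neg, ← dist_eq_norm] at h2
    linarith [min_le_left η s]
  have h1 := hL.sub_le_norm w x
  refine hL.norm_gradient_eq_one (z := w) (hd' x hxU) ?_ (by linarith)
  rintro rfl
  linarith

end SignedDistance

/-! ### Regular level sets as graphs. -/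

section Graph

variable {E : Type*} [NormedAddCommGroup E] [InnerProductSpace ℝ E] [CompleteSpace E]
  {D U : Set E} {g : E → ℝ} {p : E}

theorem norm_inv_smul_sub_inv_smul_le {V : Type*} [NormedAddCommGroup V] [NormedSpace ℝ V]
    {a b : V} {α β d : ℝ} (hα : 1 / 2 ≤ α) (hβ : 1 / 2 ≤ β) (hb : ‖b‖ ≤ 1)
    (hab : ‖a - b‖ ≤ d) (hαβ : |α - β| ≤ d) : ‖α⁻¹ • a - β⁻¹ • b‖ ≤ 6 * d := by
  have hα0 : 0 < α := by linarith
  have hβ0 : 0 < β := by linarith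
  have hd : 0 ≤ d := (abs_nonneg _).trans hαβ
  have h1 : α⁻¹ • a - β⁻¹ • b = α⁻¹ • (a - b) + (α⁻¹ * β⁻¹ * (β - α)) • b := by
    have : α⁻¹ * β⁻¹ * (β - α) = α⁻¹ - β⁻¹ := by field_simp
    rw [this]; module
  have hα' : α⁻¹ ≤ 2 := by rw [inv_le_comm₀ hα0 (by norm_num)]; linarith
  have hβ' : β⁻¹ ≤ 2 := by rw [inv_le_comm₀ hβ0 (by norm_num)]; linarith
  have h2 : ‖α⁻¹ • (a - b)‖ ≤ 2 * d := by
    rw [norm_smul, Real.norm_of_nonneg (by positivity)]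
    gcongr
  have h3 : ‖(α⁻¹ * β⁻¹ * (β - α)) • b‖ ≤ 2 * 2 * d * 1 := by
    rw [norm_smul, norm_mul, Real.norm_of_nonneg (by positivity), Real.norm_eq_abs, abs_sub_comm]
    gcongr
  rw [h1]
  linarith [norm_add_le (α⁻¹ • (a - b)) ((α⁻¹ * β⁻¹ * (β - α)) • b)]

/-- As `f` is already Lipschitz, the remainder of `g` along the graph is `o(z - y)`; dividing by the
nonzero derivative along `ν` solves for `f z - f y`. -/
theorem hasFDerivAt_implicit {E F : Type*} [NormedAddCommGroup E] [NormedSpace ℝ E]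
    [NormedAddCommGroup F] [NormedSpace ℝ F] {g : E → ℝ} {p : E}
    (ι : F →L[ℝ] E) (ν : E) {f : F → ℝ} {V : Set F} (hV : IsOpen V)
    {K : NNReal} (hf : LipschitzOnWith K f V)
    (h0 : ∀ y ∈ V, g (p + ι y + f y • ν) = 0) {y : F} (hy : y ∈ V)
    (hg : DifferentiableAt ℝ g (p + ι y + f y • ν))
    (hα : fderiv ℝ g (p + ι y + f y • ν) ν ≠ 0) :
    HasFDerivAt f (-((fderiv ℝ g (p + ι y + f y • ν) ν)⁻¹ •
      (fderiv ℝ g (p + ι y + f y • ν)).comp ι)) y := by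
  set A := fderiv ℝ g (p + ι y + f y • ν) with hA
  have hVy : V ∈ 𝓝 y := hV.mem_nhds hy
  have hfc : ContinuousAt f y := hf.continuousOn.continuousAt hVy
  have hcont : ContinuousAt (fun z => p + ι z + f z • ν) y := by
    have := ι.continuous.continuousAt (x := y)
    fun_prop
  have h1 := hg.hasFDerivAt.isLittleO.comp_tendsto hcont
  have hfO : (fun z => f z - f y) =O[𝓝 y] fun z => z - y := by
    refine Asymptotics.IsBigO.of_bound K ?_
    filter_upwards [hVy] with z hz using hf.norm_sub_le hz hy
  have h2 : (fun z => p + ι z + f z • ν - (p + ι y + f y • ν)) =O[𝓝 y] fun z => z - y := by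
    have h3 : (fun z => ι (z - y)) =O[𝓝 y] fun z => z - y := ι.isBigO_comp _ _
    have h4 : (fun z => (f z - f y) • ν) =O[𝓝 y] fun z => z - y := by
      refine (Asymptotics.IsBigO.of_bound ‖ν‖ (Eventually.of_forall fun z => ?_)).trans hfO
      rw [norm_smul, mul_comm]
    refine (h3.add h4).congr_left fun z => ?_
    rw [map_sub]; module
  have h3 := (h1.trans_isBigO h2).const_mul_left (-(A ν)⁻¹)
  refine HasFDerivAt.of_isLittleO (h3.congr' ?_ EventuallyEq.rfl)
  filter_upwards [hVy] with z hz
  simp only [Function.comp_apply, h0 z hz, h0 y hy]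
  have h5 : p + ι z + f z • ν - (p + ι y + f y • ν) = ι (z - y) + (f z - f y) • ν := by
    rw [map_sub]; module
  rw [h5, ← hA, map_add, map_smul]
  simp only [neg_apply, smul_apply,
    ContinuousLinearMap.comp_apply, smul_eq_mul]
  field_simp
  ring

/-- A regular level set of a `1`-Lipschitz function of class `C^{1,1}` is a `C^{1,1}` graph. -/
theorem isC11BoundaryPoint_of_isC11On (hp : p ∈ frontier D) (hL : LipschitzWith 1 g)
    (hU : IsOpen U) (hpU : p ∈ U) (hg : IsC11On g U) (hp0 : g p = 0)
    (hgrad : ‖gradient g p‖ = 1) (hD : ∀ x, x ∈ D ↔ 0 < g x) : IsC11BoundaryPoint D p := by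
  refine ⟨hp, gradient g p, hgrad, ?_⟩
  set ν := gradient g p with hν
  have hdiff : DifferentiableOn ℝ g U := hg.1.differentiableOn one_ne_zero
  obtain ⟨K, T, hT, hTL⟩ := hg.2 hpU
  rw [hU.nhdsWithin_eq hpU] at hT
  have hev : ∀ᶠ x in 𝓝 p, 1 / 2 < ⟪gradient g x, ν⟫ := by
    have hc : ContinuousAt (gradient g) p := hg.2.continuousOn.continuousAt (hU.mem_nhds hpU)
    have hc' : ContinuousAt (fun x => ⟪gradient g x, ν⟫) p := hc.inner continuousAt_const
    refine hc'.eventually_const_lt ?_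
    change 1 / 2 < ⟪ν, ν⟫
    rw [real_inner_self_eq_norm_sq, hgrad]
    norm_num
  obtain ⟨R, hR, hRsub⟩ := Metric.mem_nhds_iff.1
    (Filter.inter_mem (Filter.inter_mem (hU.mem_nhds hpU) hT) hev)
  -- Horizontal offset below `r` plus height at most `2r` stays within `R`.
  set r := R / 4 with hr
  have hr0 : 0 < r := by positivity
  set ι := (Submodule.span ℝ {ν})ᗮ.subtypeL with hι
  have hιn : ∀ y, ‖ι y‖ = ‖y‖ := fun y => rfl
  have hmem : ∀ y ∈ ball (0 : (Submodule.span ℝ {ν})ᗮ) r, ∀ t ∈ Icc (-(2 * r)) (2 * r),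
      p + ι y + t • ν ∈ ball p R := by
    intro y hy t ht
    rw [mem_ball_zero_iff] at hy
    rw [mem_ball, dist_eq_norm]
    have h1 : p + ι y + t • ν - p = ι y + t • ν := by abel
    have h2 : |t| ≤ 2 * r := abs_le.2 ht
    have h3 := norm_add_le (ι y) (t • ν)
    rw [norm_smul, hgrad, mul_one, Real.norm_eq_abs, hιn] at h3
    rw [h1]
    linarith
  have hmono : ∀ y ∈ ball (0 : (Submodule.span ℝ {ν})ᗮ) r, ∀ t ∈ Icc (-(2 * r)) (2 * r),
      ∀ t' ∈ Icc (-(2 * r)) (2 * r), t ≤ t' →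
      1 / 2 * (t' - t) ≤ g (p + ι y + t' • ν) - g (p + ι y + t • ν) := by
    intro y hy
    have hder : ∀ t ∈ Icc (-(2 * r)) (2 * r), HasDerivAt (fun t : ℝ => g (p + ι y + t • ν))
        ⟪gradient g (p + ι y + t • ν), ν⟫ t := by
      intro t ht
      have h2 : HasDerivAt (fun t : ℝ => p + ι y + t • ν) ν t := by
        simpa using ((hasDerivAt_id t).smul_const ν).const_add (p + ι y)
      rw [← fderiv_apply_eq_inner_gradient]
      exact (hdiff.differentiableAt
        (hU.mem_nhds (hRsub (hmem y hy t ht)).1.1)).hasFDerivAt.comp_hasDerivAt t h2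
    refine (convex_Icc (-(2 * r)) (2 * r)).mul_sub_le_image_sub_of_le_deriv
      (f := fun t : ℝ => g (p + ι y + t • ν))
      (fun t ht => (hder t ht).continuousAt.continuousWithinAt)
      (fun t ht => (hder t (interior_subset ht)).differentiableAt.differentiableWithinAt)
      fun t ht => ?_
    rw [(hder t (interior_subset ht)).deriv]
    exact (hRsub (hmem y hy t (interior_subset ht))).2.le
  have hroot : ∀ y ∈ ball (0 : (Submodule.span ℝ {ν})ᗮ) r, ∃ t ∈ Icc (-(2 * r)) (2 * r),
      g (p + ι y + t • ν) = 0 := by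
    intro y hy
    have h0 : (0 : ℝ) ∈ Icc (-(2 * r)) (2 * r) := ⟨by linarith, by linarith⟩
    have hl : -(2 * r) ∈ Icc (-(2 * r)) (2 * r) := ⟨le_rfl, by linarith⟩
    have hu : 2 * r ∈ Icc (-(2 * r)) (2 * r) := ⟨by linarith, le_rfl⟩
    -- At height 0, `|g| < r`; slope at least `1/2` over height `2r` changes `g` by at least `r`,
    -- forcing a sign change.
    have h1 := hmono y hy _ hl _ h0 (by linarith)
    have h2 := hmono y hy _ h0 _ hu (by linarith)
    have h3 := hL.sub_le_norm p (p + ι y + (0 : ℝ) • ν)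
    have h4 := hL.sub_le_norm (p + ι y + (0 : ℝ) • ν) p
    have h5 : p + ι y + (0 : ℝ) • ν - p = ι y := by rw [zero_smul]; abel
    rw [norm_sub_rev, h5, hιn, hp0] at h3
    rw [h5, hιn, hp0] at h4
    rw [mem_ball_zero_iff] at hy
    have hc : ContinuousOn (fun t : ℝ => g (p + ι y + t • ν)) (Icc (-(2 * r)) (2 * r)) := by
      have := hL.continuous
      fun_prop
    exact intermediate_value_Icc (by linarith) hc
      (show (0 : ℝ) ∈ Icc _ _ from ⟨by linarith, by linarith⟩)
  choose! f hfI hf0 using hroot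
  have hfle : ∀ y ∈ ball (0 : (Submodule.span ℝ {ν})ᗮ) r,
      ∀ y' ∈ ball (0 : (Submodule.span ℝ {ν})ᗮ) r, f y' ≤ f y + 2 * dist y' y := by
    intro y hy y' hy'
    rcases le_total (f y') (f y) with h | h
    · linarith [dist_nonneg (x := y') (y := y)]
    · have h1 := hmono y' hy' _ (hfI y hy) _ (hfI y' hy') h
      have h2 := hL.sub_le_norm (p + ι y + f y • ν) (p + ι y' + f y • ν)
      have h3 : p + ι y + f y • ν - (p + ι y' + f y • ν) = ι (y - y') := by
        rw [map_sub]; abel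
      rw [h3, hιn, ← dist_eq_norm, dist_comm, hf0 y hy] at h2
      rw [hf0 y' hy'] at h1
      linarith
  have hfL : LipschitzOnWith 2 f (ball 0 r) :=
    LipschitzOnWith.of_le_add_mul 2 fun y' hy' y hy => by exact_mod_cast hfle y hy y' hy'
  have hRf : ∀ y ∈ ball (0 : (Submodule.span ℝ {ν})ᗮ) r, p + ι y + f y • ν ∈ ball p R :=
    fun y hy => hmem y hy _ (hfI y hy)
  have hα : ∀ y ∈ ball (0 : (Submodule.span ℝ {ν})ᗮ) r,
      1 / 2 ≤ fderiv ℝ g (p + ι y + f y • ν) ν := fun y hy => by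
    rw [fderiv_apply_eq_inner_gradient]
    exact (hRsub (hRf y hy)).2.le
  have hder : ∀ y ∈ ball (0 : (Submodule.span ℝ {ν})ᗮ) r, HasFDerivAt f
      (-((fderiv ℝ g (p + ι y + f y • ν) ν)⁻¹ • (fderiv ℝ g (p + ι y + f y • ν)).comp ι)) y :=
    fun y hy => hasFDerivAt_implicit ι ν isOpen_ball hfL hf0 hy
      (hdiff.differentiableAt (hU.mem_nhds (hRsub (hRf y hy)).1.1))
      (by linarith [hα y hy])
  refine ⟨r, hr0, f, isC11On_of_locallyLipschitzOn_gradient isOpen_ball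
    (fun y hy => (hder y hy).differentiableAt.differentiableWithinAt) ?_, ?_⟩
  · have hlip : LipschitzOnWith (6 * (K * 3)) (gradient f) (ball 0 r) := by
      refine LipschitzOnWith.of_dist_le_mul fun y hy z hz => ?_
      rw [gradient, gradient, LinearIsometryEquiv.dist_map, (hder y hy).fderiv,
        (hder z hz).fderiv, dist_neg_neg, dist_eq_norm]
      have hιle : ‖ι‖ ≤ 1 := Submodule.norm_subtypeL_le _
      have h1 : ‖fderiv ℝ g (p + ι y + f y • ν) - fderiv ℝ g (p + ι z + f z • ν)‖
          ≤ K * (3 * dist y z) := by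
        rw [← toDual_gradient, ← toDual_gradient, ← map_sub, LinearIsometryEquiv.norm_map,
          ← dist_eq_norm]
        refine (hTL.dist_le_mul _ (hRsub (hRf y hy)).1.2 _ (hRsub (hRf z hz)).1.2).trans ?_
        gcongr
        have h2 : p + ι y + f y • ν - (p + ι z + f z • ν) = ι (y - z) + (f y - f z) • ν := by
          rw [map_sub]; module
        have h3 := hfL.norm_sub_le hy hz
        rw [dist_eq_norm, h2]
        refine (norm_add_le _ _).trans ?_
        rw [hιn, norm_smul, hgrad, mul_one, dist_eq_norm]
        push_cast at h3
        linarith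
      have h4 := norm_inv_smul_sub_inv_smul_le (hα y hy) (hα z hz)
        (a := (fderiv ℝ g (p + ι y + f y • ν)).comp ι)
        (b := (fderiv ℝ g (p + ι z + f z • ν)).comp ι) (d := K * (3 * dist y z)) ?_ ?_ ?_
      · refine h4.trans (le_of_eq ?_)
        push_cast
        ring
      · refine (ContinuousLinearMap.opNorm_comp_le _ _).trans ?_
        rw [← norm_gradient]
        exact mul_le_one₀ (hL.norm_gradient_le_one _) (norm_nonneg _) hιle
      · rw [← ContinuousLinearMap.sub_comp]
        refine (ContinuousLinearMap.opNorm_comp_le _ _).trans ?_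
        exact (mul_le_of_le_one_right (norm_nonneg _) hιle).trans h1
      · rw [← sub_apply, ← Real.norm_eq_abs]
        refine (ContinuousLinearMap.le_opNorm _ _).trans ?_
        rw [hgrad, mul_one]
        exact h1
    intro y hy
    exact ⟨_, ball 0 r, self_mem_nhdsWithin, hlip⟩
  · intro y hy t ht
    have htI : t ∈ Icc (-(2 * r)) (2 * r) := ⟨by linarith [ht.1], by linarith [ht.2]⟩
    rw [hD]
    change 0 < g (p + ι y + t • ν) ↔ _
    constructor
    · intro h
      by_contra! hle
      have := hmono y hy _ htI _ (hfI y hy) hle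
      rw [hf0 y hy] at this
      linarith
    · intro h
      have := hmono y hy _ (hfI y hy) _ htI h.le
      rw [hf0 y hy] at this
      linarith

end Graph

theorem corollary2p5 (m : ℕ) (hm : 2 ≤ m)
    (D : Set (EuclideanSpace ℝ (Fin m))) (hD : IsOpen D)
    (p : EuclideanSpace ℝ (Fin m)) (hp : p ∈ frontier D)
    (U : Set (EuclideanSpace ℝ (Fin m))) (hU : IsOpen U) (hpU : p ∈ U)
    (hd : DifferentiableOn ℝ (signedDistance D) U) :
    IsC11On (signedDistance D) U ∧ IsC11BoundaryPoint D p := by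
  have hL := lipschitzWith_signedDistance D
  have hgrad : ∀ z ∈ U, ‖gradient (signedDistance D) z‖ = 1 := fun z hz => by
    by_cases hzf : z ∈ frontier D
    · exact norm_gradient_signedDistance_of_mem_frontier hD hU hd hz hzf
    · exact norm_gradient_signedDistance_of_notMem_frontier ⟨p, hp⟩ hzf
        (hd.differentiableAt (hU.mem_nhds hz))
  have hC := hL.isC11On_of_norm_gradient_eq_one hU hd hgrad
  exact ⟨hC, isC11BoundaryPoint_of_isC11On hp hL hU hpU hC (signedDistance_of_mem_frontier hp)
    (hgrad p hpU) fun _ => (signedDistance_pos_iff hD ⟨p, hp⟩).symm⟩
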